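/- All varieties are defined over $\overline{\mathbb Q}$ and identified with their sets of $\overline{\mathbb Q}$-points, with the Zariski topology. Let $A$ be an abelian variety over $\overline{\mathbb Q}$; for $X\subseteq A$ write $\operatorname{codim} X=\dim A-\dim X$. An algebraic subgroup of $A$ is a Zariski closed subgroup. A torsion variety in $A$ is a finite union of sets $B+\zeta$ with $B\subsetneq A$ a proper algebraic subgroup and $\zeta\in A$ a torsion point. An irreducible closed subvariety $V\subseteq A$ is weak-transverse if it is not contained in any torsion variety. For such a $V$, a $V$-torsion anomalous variety is an irreducible component $Y$ of $V\cap(B+\zeta)$, for some irreducible torsion variety $B+\zeta$ ($B$ a proper algebraic subgroup, $\zeta$ a torsion point), such that $$\operatorname{codim} Y<\operatorname{codim} V+\operatorname{codim} B .$$ Theorem. Let $H$ be an algebraic subgroup of $A$ and let $p\in A$ be such that the translate $H+p$ is weak-transverse. Then the set of $(H+p)$-torsion anomalous varieties is empty. -/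

import Mathlib

open CategoryTheory AlgebraicGeometry MonoidalCategory
open scoped MonObj Pointwise

universe u

namespace TorsionAnomalous

variable {K : Type u} [Field K]

/-- The set `A(K)` of `K`-rational points of a `K`-scheme `A`. Over an algebraically closed field
the classical variety underlying `A` is this set with its Zariski topology, and the subvarieties
of `A` are its closed subsets. -/
def Point (A : Over (Spec (.of K))) : Type u := 𝟙_ (Over (Spec (.of K))) ⟶ A

/-- The point of the underlying space of the scheme `A` that is the image of a `K`-point. -/
noncomputable def Point.toScheme {A : Over (Spec (.of K))} (x : Point A) : A.left :=
  (show 𝟙_ (Over (Spec (.of K))) ⟶ A from x).left (IsLocalRing.closedPoint K)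

/-- The Zariski topology on `A(K)`. -/
noncomputable instance (A : Over (Spec (.of K))) : TopologicalSpace (Point A) :=
  TopologicalSpace.induced Point.toScheme inferInstance

/-- The group structure on `A(K)`, for a group scheme `A`. It is written multiplicatively: the
translate `H + p` is `p • (H : Set (Point A))`. For an abelian variety it is commutative. -/
noncomputable instance (A : Over (Spec (.of K))) [GrpObj A] : Group (Point A) :=
  inferInstanceAs (Group (𝟙_ (Over (Spec (.of K))) ⟶ A))

/-- The dimension of a subset of `A(K)`, that is the Krull dimension of the Zariski topology on it.
(It is finite when `A` is of finite type over `K`. The value for the empty set is `0` by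
convention; only non-empty sets are used.) -/
noncomputable def dim {A : Over (Spec (.of K))} (X : Set (Point A)) : ℕ :=
  ((topologicalKrullDim X).unbotD 0).toNat

/-- The codimension of `X` in `A`, that is `dim A - dim X`. -/
noncomputable def codim {A : Over (Spec (.of K))} (X : Set (Point A)) : ℤ :=
  (dim (Set.univ : Set (Point A)) : ℤ) - dim X

/-- `Y` is an irreducible component of the set `X`: a maximal irreducible subset of `X`. -/
def IsIrreducibleComponentOf {A : Over (Spec (.of K))} (Y X : Set (Point A)) : Prop :=
  Maximal (fun Z : Set (Point A) => IsIrreducible Z ∧ Z ⊆ X) Y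

variable {A : Over (Spec (.of K))} [GrpObj A]

/-- An algebraic subgroup of `A`: a Zariski closed subgroup of `A(K)`. -/
def IsAlgebraicSubgroup (H : Subgroup (Point A)) : Prop := IsClosed (H : Set (Point A))

/-- `B + ζ` is a translate of a proper algebraic subgroup by a torsion point. -/
def IsTorsionTranslate (B : Subgroup (Point A)) (ζ : Point A) : Prop :=
  IsAlgebraicSubgroup B ∧ B ≠ ⊤ ∧ IsOfFinOrder ζ

/-- A torsion variety: a finite union of translates of proper algebraic subgroups by torsion
points. -/
def IsTorsionVariety (T : Set (Point A)) : Prop :=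
  ∃ S : Set (Set (Point A)), S.Finite ∧
    (∀ C ∈ S, ∃ (B : Subgroup (Point A)) (ζ : Point A),
      IsTorsionTranslate B ζ ∧ C = ζ • (B : Set (Point A))) ∧
    T = ⋃₀ S

/-- An irreducible variety is weak-transverse if it is not contained in any torsion variety. -/
def IsWeakTransverse (V : Set (Point A)) : Prop :=
  IsClosed V ∧ IsIrreducible V ∧ ∀ T : Set (Point A), IsTorsionVariety T → ¬ V ⊆ T

/-- `Y` is a `V`-torsion anomalous variety: it is an irreducible component of `V ∩ (B + ζ)` for
some irreducible torsion variety `B + ζ`, and its dimension is larger than expected. -/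
def IsTorsionAnomalous (V Y : Set (Point A)) : Prop :=
  ∃ (B : Subgroup (Point A)) (ζ : Point A),
    IsTorsionTranslate B ζ ∧ IsIrreducible (ζ • (B : Set (Point A))) ∧
    IsIrreducibleComponentOf Y (V ∩ ζ • (B : Set (Point A))) ∧
    codim Y < codim V + codim (B : Set (Point A))

end TorsionAnomalous

/-! ### Topology: Krull dimension, Jacobson spaces, invariant closed maps -/

section

open Set Topology TopologicalSpace Order

namespace TorsionAnomalous

/-! Additively: suppose `Y` is a component of `(H + p) ∩ (B + ζ)`, and pick `y ∈ Y`. Then `H + p = H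
+ y` lies in `(H + B) + ζ`, and `H + B` is closed because `A` is proper. If `H + B ≠ A`, this is a
torsion variety containing `H + p`, which weak-transversality forbids. So `H + B = A`, and `E = Y -
y` is an irreducible subset of `H ∩ B` through the origin. It remains to see `dim A + dim E ≤ dim H
+ dim B`, which contradicts anomaly.

The upper bound `dim (H × B) ≤ dim H + dim B` comes from Noether normalization on affine charts; the
Jacobson property transfers it to `K`-points.

The lower bound `dim A + dim E ≤ dim (H × B)` avoids fibre dimension theory. The sum map `H × B → A`
is a closed surjection, invariant under the shears `(x, y) ↦ (x + d, -d + y)` with `d ∈ E`. A chain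
of irreducible closed sets in `A` lifts to a chain of shear-stable ones
(`exists_stable_irreducibleCloseds`), and the smallest of these contains an orbit, a copy of `E`,
which prolongs the chain downwards by `dim E` (`add_le_height_of_stable`). -/

/-- If a space is covered by opens of dimension at most `n`, then it has dimension at most `n`. -/
theorem topologicalKrullDim_le_of_forall_isOpenEmbedding {X : Type*} [TopologicalSpace X]
    (n : WithBot ℕ∞)
    (h : ∀ x : X, ∃ (U : Type*) (_ : TopologicalSpace U) (j : U → X),
      IsOpenEmbedding j ∧ x ∈ range j ∧ topologicalKrullDim U ≤ n) :
    topologicalKrullDim X ≤ n := by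
  -- Coheight is the local choice: every irreducible closed set above `Z` still contains `x`, so one
  -- chart around `x` sees the whole chain.
  rw [topologicalKrullDim, krullDim_eq_iSup_coheight]
  refine iSup_le fun Z => ?_
  obtain ⟨x, hx⟩ := Z.isIrreducible.nonempty
  obtain ⟨U, _, j, hj, ⟨u, rfl⟩, hU⟩ := h x
  obtain ⟨W, rfl⟩ : ∃ W, IrreducibleCloseds.map j hj.continuous W = Z := by
    refine ⟨⟨j ⁻¹' Z, Z.isIrreducible.preimage hj ⟨_, hx, u, rfl⟩,
      Z.isClosed.preimage hj.continuous⟩, ?_⟩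
    apply IrreducibleCloseds.ext
    rw [IrreducibleCloseds.coe_map]
    change closure (j '' (j ⁻¹' Z)) = Z
    rw [image_preimage_eq_inter_range]
    refine (closure_minimal inter_subset_left Z.isClosed).antisymm ?_
    exact subset_closure_inter_of_isPreirreducible_of_isOpen Z.isIrreducible.isPreirreducible
      hj.isOpen_range ⟨_, hx, u, rfl⟩
  rw [hj.coheight_map]
  exact (coheight_le_krullDim W).trans hU

/-- A closed subset `T` of a Jacobson space has at most the dimension of its set of closed
points. -/
theorem topologicalKrullDim_le_of_range_eq_closedPoints {P S T : Type*} [TopologicalSpace P]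
    [TopologicalSpace S] [TopologicalSpace T] [JacobsonSpace S] {j : P → S} {i : T → S}
    (hj : IsInducing j) (hi : IsClosedEmbedding i) (hr : range j = closedPoints S ∩ range i) :
    topologicalKrullDim T ≤ topologicalKrullDim P := by
  -- Nonempty locally closed sets in a Jacobson space contain a closed point, so points of `P`
  -- detect them.
  have key : ∀ (Z : Set S), IsClosed Z → ∀ (U : Set S), IsOpen U → (Z ∩ U ∩ range i).Nonempty →
      ∃ x, j x ∈ Z ∩ U := by
    intro Z hZ U hU hne
    obtain ⟨s, ⟨hs, hsi⟩, hc⟩ := nonempty_inter_closedPoints hne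
      ((hZ.isLocallyClosed.inter hU.isLocallyClosed).inter hi.isClosed_range.isLocallyClosed)
    obtain ⟨x, rfl⟩ : s ∈ range j := hr ▸ ⟨hc, hsi⟩
    exact ⟨x, hs⟩
  let F : IrreducibleCloseds T → IrreducibleCloseds P := fun W =>
    { carrier := j ⁻¹' (i '' W)
      isIrreducible' := by
        have hW := W.isIrreducible.image i hi.continuous.continuousOn
        have hc : IsClosed (i '' (W : Set T)) := hi.isClosedMap _ W.isClosed
        refine ⟨?_, ?_⟩
        · obtain ⟨w, hw⟩ := hW.nonempty
          obtain ⟨x, hx⟩ := key _ hc univ isOpen_univ ⟨w, ⟨hw, trivial⟩, image_subset_range _ _ hw⟩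
          exact ⟨x, hx.1⟩
        · intro u v hu hv hxu hxv
          obtain ⟨u, hu', rfl⟩ := hj.isOpen_iff.1 hu
          obtain ⟨v, hv', rfl⟩ := hj.isOpen_iff.1 hv
          obtain ⟨x, hx⟩ := hxu
          obtain ⟨y, hy⟩ := hxv
          obtain ⟨s, hs, hsuv⟩ := hW.isPreirreducible u v hu' hv' ⟨_, hx⟩ ⟨_, hy⟩
          obtain ⟨z, hz⟩ := key _ hc (u ∩ v) (hu'.inter hv')
            ⟨s, ⟨hs, hsuv⟩, image_subset_range _ _ hs⟩
          exact ⟨z, hz⟩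
      isClosed' := (hi.isClosedMap _ W.isClosed).preimage hj.continuous }
  refine krullDim_le_of_strictMono F fun W W' hlt => ?_
  refine lt_of_le_of_ne (preimage_mono (f := j) (image_mono (f := i) hlt.le)) fun he => ?_
  obtain ⟨t, ht, ht'⟩ := not_subset.1 hlt.not_ge
  obtain ⟨x, hx⟩ := key _ (hi.isClosedMap _ W'.isClosed) (i '' W)ᶜ
    (hi.isClosedMap _ W.isClosed).isOpen_compl
    ⟨i t, ⟨mem_image_of_mem _ ht, fun h => ht' ((hi.injective.mem_set_image).1 h)⟩, t, rfl⟩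
  have h1 : x ∈ F W' := hx.1
  rw [← he] at h1
  exact hx.2 h1

/-! ### Lifting chains along an invariant closed map -/

section Action

variable {D G A : Type*} [TopologicalSpace D] [TopologicalSpace G] [TopologicalSpace A]
  [IrreducibleSpace D] {a : D → G → G} {e : D}

/-- The orbit of an irreducible set under an irreducible family of transformations is
irreducible. -/
theorem isPreirreducible_iUnion_image (h1 : ∀ d, Continuous (a d))
    (h2 : ∀ x, Continuous fun d => a d x) {X : Set G} (hX : IsPreirreducible X) :
    IsPreirreducible (⋃ d, a d '' X) := by
  intro u v hu hv hxu hxv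
  obtain ⟨_, hx', hxu⟩ := hxu
  obtain ⟨_, hy', hyv⟩ := hxv
  obtain ⟨d, x, hx, rfl⟩ := mem_iUnion.1 hx'
  obtain ⟨d', y, hy, rfl⟩ := mem_iUnion.1 hy'
  -- Irreducibility of `D` gives one parameter `c` moving `x` into `u` and `y` into `v`.
  obtain ⟨c, -, hc1, hc2⟩ := (IrreducibleSpace.isIrreducible_univ D).isPreirreducible _ _
    (hu.preimage (h2 x)) (hv.preimage (h2 y)) ⟨d, trivial, hxu⟩ ⟨d', trivial, hyv⟩
  obtain ⟨z, hz, hz1, hz2⟩ := hX _ _ (hu.preimage (h1 c)) (hv.preimage (h1 c))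
    ⟨x, hx, hc1⟩ ⟨y, hy, hc2⟩
  exact ⟨a c z, mem_iUnion.2 ⟨c, z, hz, rfl⟩, hz1, hz2⟩

variable [NoetherianSpace G] {f : G → A}

/-- A stable closed set with irreducible image contains a stable irreducible closed set with the
same image. -/
theorem exists_stable_irreducibleCloseds (h1 : ∀ d, Continuous (a d))
    (h2 : ∀ x, Continuous fun d => a d x) (he : ∀ x, a e x = x)
    (hfc : IsClosedMap f) {F : Set G} (hF : IsClosed F) (hFs : ∀ d, MapsTo (a d) F F)
    (hFi : IsIrreducible (f '' F)) :
    ∃ X : IrreducibleCloseds G, (X : Set G) ⊆ F ∧ (∀ d, MapsTo (a d) X X) ∧ f '' X = f '' F := by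
  obtain ⟨S, hSf, hS, hSF⟩ := NoetherianSpace.exists_finite_set_isClosed_irreducible hF
  have hcov : ∀ T : Set G, IsIrreducible T → T ⊆ F → ∃ s ∈ S, T ⊆ s := by
    intro T hT hTF
    obtain ⟨s, hs, hTs⟩ := isIrreducible_iff_sUnion_isClosed.1 hT hSf.toFinset
      (fun z hz => hS z (hSf.mem_toFinset.1 hz)) (by simpa [← hSF.2] using hTF)
    exact ⟨s, hSf.mem_toFinset.1 hs, hTs⟩
  obtain ⟨s, hs, hFs'⟩ : ∃ s ∈ S, f '' F ⊆ f '' s := by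
    classical
    obtain ⟨t, ht, hle⟩ := isIrreducible_iff_sUnion_isClosed.1 hFi
      (hSf.toFinset.image (image f)) (by
        intro z hz
        obtain ⟨s, hs, rfl⟩ := Finset.mem_image.1 hz
        exact hfc _ (hS s (hSf.mem_toFinset.1 hs))) (by
        rintro _ ⟨x, hx, rfl⟩
        rw [hSF.2] at hx
        obtain ⟨s, hs, hx⟩ := hx
        exact ⟨f '' s, by simpa using ⟨s, hs, rfl⟩, x, hx, rfl⟩)
    obtain ⟨s, hs, rfl⟩ := Finset.mem_image.1 ht
    exact ⟨s, hSf.mem_toFinset.1 hs, hle⟩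
  -- The family `S` may be redundant, so enlarge `s` to a maximal member; maximality will force
  -- stability.
  obtain ⟨X, hsX, hX⟩ := hSf.exists_le_maximal hs
  have hXF : X ⊆ F := by rw [hSF.2]; exact subset_sUnion_of_mem hX.prop
  have hXi : IsIrreducible X := hSF.1 X hX.prop
  refine ⟨⟨X, hXi, hS X hX.prop⟩, hXF, fun d x hx => ?_,
    (image_mono hXF).antisymm (hFs'.trans (image_mono hsX))⟩
  -- The orbit of `X` is irreducible, lies in `F` and contains `X`; hence it lies in a member of
  -- `S`, which can only be `X`.
  have hsub : X ⊆ ⋃ d, a d '' X := fun x hx => mem_iUnion.2 ⟨e, x, hx, he x⟩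
  obtain ⟨t, ht, hXt⟩ := hcov (⋃ d, a d '' X)
    ⟨hXi.nonempty.mono hsub, isPreirreducible_iUnion_image h1 h2 hXi.isPreirreducible⟩ (by
      refine iUnion_subset fun d => ?_
      rintro _ ⟨x, hx, rfl⟩
      exact hFs d (hXF hx))
  have := hX.le_of_ge ht (hsub.trans hXt)
  exact this (hXt (mem_iUnion.2 ⟨d, x, hx, rfl⟩))

/-- A stable irreducible closed set `X` whose image `Y` has height at least `n` has height at least
`n + dim D`. -/
theorem add_le_height_of_stable (h1 : ∀ d, Continuous (a d))
    (h2 : ∀ x, IsInducing fun d => a d x) (he : ∀ x, a e x = x) (hf : Continuous f)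
    (hfc : IsClosedMap f) (hfa : ∀ d x, f (a d x) = f x) {m : ℕ}
    (hm : m ≤ topologicalKrullDim D) (n : ℕ) :
    ∀ (Y : IrreducibleCloseds A), n ≤ height Y → ∀ X : IrreducibleCloseds G,
      (∀ d, MapsTo (a d) X X) → f '' X = Y → (n + m : ℕ) ≤ height X := by
  induction n with
  | zero =>
    intro Y _ X hX _
    obtain ⟨x, hx⟩ := X.isIrreducible.nonempty
    obtain ⟨q, hq⟩ := le_krullDim_iff.1 hm
    -- Closures of the images, under the orbit map of `x`, of a chain in `D` of length `m`.
    let q' := q.map _ (IrreducibleCloseds.map_strictMono_of_isInducing (h2 x))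
    have : q'.last ≤ X := by
      change closure ((fun d => a d x) '' _) ⊆ (X : Set G)
      refine closure_minimal ?_ X.isClosed
      rintro _ ⟨d, -, rfl⟩
      exact hX d hx
    rw [zero_add, ← hq]
    exact length_le_height (p := q') this
  | succ n ih =>
    intro Y hY X hX hXY
    obtain ⟨Y', hlt, hY'⟩ : ∃ Y' < Y, (n : ℕ∞) ≤ height Y' := by
      by_contra! hcon
      have := height_le_coe_iff.2 hcon
      have := hY.trans this
      norm_cast at this
      omega
    have hne : f '' (X ∩ f ⁻¹' Y') = Y' := by
      rw [image_inter_preimage, hXY]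
      exact inter_eq_right.2 hlt.le
    obtain ⟨X', hX'X, hX's, hX'Y⟩ := exists_stable_irreducibleCloseds h1
      (fun x => (h2 x).continuous) he hfc (X.isClosed.inter (Y'.isClosed.preimage hf))
      (fun d x hx => ⟨hX d hx.1, by simpa [hfa] using hx.2⟩) (by rw [hne]; exact Y'.isIrreducible)
    have h3 := ih Y' hY' X' hX's (hX'Y.trans hne)
    have hlt' : X' < X := by
      refine lt_of_le_of_ne (hX'X.trans inter_subset_left) ?_
      rintro rfl
      exact hlt.ne (IrreducibleCloseds.ext ((hX'Y.trans hne).symm.trans hXY))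
    calc ((n + 1 + m : ℕ) : ℕ∞) = (n + m : ℕ) + 1 := by push_cast; ring
      _ ≤ height X' + 1 := by gcongr
      _ ≤ height X := height_add_one_le hlt'

/-- If `f : G → A` is a closed continuous surjection, invariant under an irreducible family `D` of
transformations of `G` whose orbit maps are inducing, then `dim A + dim D ≤ dim G`. -/
theorem add_le_topologicalKrullDim_of_invariant (h1 : ∀ d, Continuous (a d))
    (h2 : ∀ x, IsInducing fun d => a d x) (he : ∀ x, a e x = x) (hf : Continuous f)
    (hfc : IsClosedMap f) (hfs : f.Surjective) (hfa : ∀ d x, f (a d x) = f x) {m n : ℕ}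
    (hm : m ≤ topologicalKrullDim D) (hn : n ≤ topologicalKrullDim A) :
    (n + m : ℕ) ≤ topologicalKrullDim G := by
  obtain ⟨p, hp⟩ := le_krullDim_iff.1 hn
  have him : f '' (f ⁻¹' p.last) = p.last := image_preimage_eq _ hfs
  obtain ⟨X, hXF, hXs, hXY⟩ := exists_stable_irreducibleCloseds h1
    (fun x => (h2 x).continuous) he hfc (p.last.isClosed.preimage hf)
    (fun d x hx => by simpa [hfa] using hx) (by rw [him]; exact p.last.isIrreducible)
  have := add_le_height_of_stable h1 h2 he hf hfc hfa hm n p.last (hp ▸ length_le_height_last)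
    X hXs (hXY.trans him)
  exact (WithBot.coe_le_coe.2 this).trans (height_le_krullDim X)

end Action

end TorsionAnomalous

end

/-! ### Commutative algebra: dimension of a tensor product -/

section

open Algebra
open scoped TensorProduct

namespace TorsionAnomalous

/-- Incomparability: contraction of primes along an integral map is strictly monotone. -/
theorem ringKrullDim_le_of_isIntegral {R S : Type*} [CommRing R] [CommRing S] (f : R →+* S)
    (hf : f.IsIntegral) : ringKrullDim S ≤ ringKrullDim R := by
  algebraize [f]
  refine Order.krullDim_le_of_strictMono (PrimeSpectrum.comap (algebraMap R S)) fun P Q h => ?_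
  exact Ideal.IsIntegral.comap_lt_comap (R := R) (I := P.asIdeal) (J := Q.asIdeal) h

/-- Lying over for the bottom prime of a chain, then going up for the rest. -/
theorem ringKrullDim_le_of_isIntegral_of_injective {R S : Type*} [CommRing R] [CommRing S]
    (f : R →+* S) (hf : f.IsIntegral) (hinj : Function.Injective f) :
    ringKrullDim R ≤ ringKrullDim S := by
  algebraize [f]
  refine iSup_le fun l => ?_
  obtain ⟨Q, -, hQ, hQl⟩ := Ideal.exists_ideal_over_prime_of_isIntegral (S := S) l.head.asIdeal ⊥
    (by
      intro x hx
      have : x = 0 := hinj (by simpa [RingHom.algebraMap_toAlgebra] using hx)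
      simp [this])
  have : Q.LiesOver l.head.asIdeal := ⟨hQl.symm⟩
  obtain ⟨L, hL, -⟩ := Ideal.exists_ltSeries_of_hasGoingUp (S := S) l Q
  rw [← hL]
  exact Order.LTSeries.length_le_krullDim L

/-- Noether normalization. Injectivity serves only to identify `s` with the dimension. -/
theorem exists_integral_mvPolynomial (K R : Type*) [Field K] [CommRing R] [Nontrivial R]
    [Algebra K R] [FiniteType K R] :
    ∃ (s : ℕ) (g : MvPolynomial (Fin s) K →ₐ[K] R), g.IsIntegral ∧ ringKrullDim R = s := by
  obtain ⟨s, g, hg, hi⟩ := exists_integral_inj_algHom_of_fg K R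
  have hd : ringKrullDim (MvPolynomial (Fin s) K) = s := by
    simp [MvPolynomial.ringKrullDim_of_isNoetherianRing, ringKrullDim_eq_zero_of_field]
  refine ⟨s, g, hi, le_antisymm ?_ ?_⟩
  · exact hd ▸ ringKrullDim_le_of_isIntegral g.toRingHom hi
  · exact hd ▸ ringKrullDim_le_of_isIntegral_of_injective g.toRingHom hi hg

theorem ringKrullDim_lt_top_of_finiteType (K R : Type*) [Field K] [CommRing R] [Algebra K R]
    [FiniteType K R] : ringKrullDim R < ⊤ := by
  cases subsingleton_or_nontrivial R
  · rw [ringKrullDim_eq_bot_of_subsingleton]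
    exact bot_lt_top
  · obtain ⟨s, -, -, h⟩ := exists_integral_mvPolynomial K R
    rw [h]
    exact WithBot.coe_lt_coe.2 (ENat.natCast_lt_top s)

/-- Two algebra maps that are integral have an integral tensor product. -/
theorem isIntegral_tensorProduct_map {K A B R S : Type*} [CommRing K] [CommRing A] [CommRing B]
    [CommRing R] [CommRing S] [Algebra K A] [Algebra K B] [Algebra K R] [Algebra K S]
    {g : A →ₐ[K] R} {g' : B →ₐ[K] S} (hg : g.toRingHom.IsIntegral)
    (hg' : g'.toRingHom.IsIntegral) :
    (Algebra.TensorProduct.map g g').toRingHom.IsIntegral := by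
  set φ : A ⊗[K] B →+* R ⊗[K] S := (Algebra.TensorProduct.map g g').toRingHom with hφ
  have h1 (r : R) : φ.IsIntegralElem (r ⊗ₜ 1) := by
    have h := (hg r).map
      (Algebra.TensorProduct.includeLeft (R := K) (S := K) (A := R) (B := S)).toRingHom
    have e : (Algebra.TensorProduct.includeLeft (R := K) (S := K) (A := R) (B := S)).toRingHom.comp
        g.toRingHom = φ.comp
          (Algebra.TensorProduct.includeLeft (R := K) (S := K) (A := A) (B := B)).toRingHom := by
      ext a
      simp [hφ]
    rw [e] at h
    exact RingHom.isIntegralElem.of_comp _ _ h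
  have h2 (s : S) : φ.IsIntegralElem (1 ⊗ₜ s) := by
    have h := (hg' s).map
      (Algebra.TensorProduct.includeRight (R := K) (A := R) (B := S)).toRingHom
    have e : (Algebra.TensorProduct.includeRight (R := K) (A := R) (B := S)).toRingHom.comp
        g'.toRingHom = φ.comp
          (Algebra.TensorProduct.includeRight (R := K) (A := A) (B := B)).toRingHom := by
      ext a
      simp [hφ]
    rw [e] at h
    exact RingHom.isIntegralElem.of_comp _ _ h
  intro x
  induction x with
  | zero => exact φ.isIntegralElem_zero
  | add x y hx hy => exact hx.add _ hy
  | tmul r s => simpa using (h1 r).mul _ (h2 s)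

/-- Tensoring two Noether normalizations makes `R ⊗ S` integral over a polynomial ring in `s + t`
variables. -/
theorem ringKrullDim_tensorProduct_le (K R S : Type*) [Field K] [CommRing R] [Algebra K R]
    [FiniteType K R] [CommRing S] [Algebra K S] [FiniteType K S] :
    ringKrullDim (R ⊗[K] S) ≤ ringKrullDim R + ringKrullDim S := by
  cases subsingleton_or_nontrivial (R ⊗[K] S)
  · rw [ringKrullDim_eq_bot_of_subsingleton]
    exact bot_le
  have : Nontrivial R :=
    (Algebra.TensorProduct.includeLeftRingHom (R := K) (A := R) (B := S)).domain_nontrivial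
  have : Nontrivial S :=
    (Algebra.TensorProduct.includeRight (R := K) (A := R) (B := S)).toRingHom.domain_nontrivial
  obtain ⟨s, g, hg, hs⟩ := exists_integral_mvPolynomial K R
  obtain ⟨t, g', hg', ht⟩ := exists_integral_mvPolynomial K S
  refine (ringKrullDim_le_of_isIntegral _ (isIntegral_tensorProduct_map hg hg')).trans ?_
  rw [ringKrullDim_eq_of_ringEquiv
    (MvPolynomial.algebraTensorAlgEquiv K (MvPolynomial (Fin s) K)).toRingEquiv, hs, ht]
  simp [MvPolynomial.ringKrullDim_of_isNoetherianRing, ringKrullDim_eq_zero_of_field]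

end TorsionAnomalous

end

/-! ### Dimension of products of schemes -/

section

open CategoryTheory AlgebraicGeometry Limits Topology
namespace TorsionAnomalous
variable {K : Type u} [Field K]

theorem topologicalKrullDim_pullback_Spec_le {R S : CommRingCat.{u}} (f : Spec R ⟶ Spec (.of K))
    (g : Spec S ⟶ Spec (.of K)) [LocallyOfFiniteType f] [LocallyOfFiniteType g] :
    topologicalKrullDim ↥(pullback f g) ≤
      topologicalKrullDim ↥(Spec R) + topologicalKrullDim ↥(Spec S) := by
  obtain ⟨φ, rfl⟩ := Spec.map_surjective f
  obtain ⟨ψ, rfl⟩ := Spec.map_surjective g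
  have h1 : φ.hom.FiniteType :=
    (HasRingHomProperty.Spec_iff (P := @LocallyOfFiniteType)).1 inferInstance
  have h2 : ψ.hom.FiniteType :=
    (HasRingHomProperty.Spec_iff (P := @LocallyOfFiniteType)).1 inferInstance
  algebraize [φ.hom, ψ.hom]
  let e := pullbackSpecIso K R S
  have h3 : topologicalKrullDim ↥(pullback (Spec.map φ) (Spec.map ψ)) ≤
      topologicalKrullDim (PrimeSpectrum (TensorProduct K R S)) :=
    Topology.IsInducing.topologicalKrullDim_le (f := e.hom) e.hom.homeomorph.isInducing
  have h4 : topologicalKrullDim (PrimeSpectrum R) = _ :=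
    PrimeSpectrum.topologicalKrullDim_eq_ringKrullDim R
  have h5 : topologicalKrullDim (PrimeSpectrum S) = _ :=
    PrimeSpectrum.topologicalKrullDim_eq_ringKrullDim S
  rw [PrimeSpectrum.topologicalKrullDim_eq_ringKrullDim] at h3
  exact (h3.trans (ringKrullDim_tensorProduct_le K R S)).trans_eq
    (congrArg₂ (· + ·) h4 h5).symm

/-- The dimension of a product of schemes locally of finite type over a field is at most the sum
of the dimensions. -/
theorem topologicalKrullDim_pullback_le {X Y : Scheme.{u}} (f : X ⟶ Spec (.of K))
    (g : Y ⟶ Spec (.of K)) [LocallyOfFiniteType f] [LocallyOfFiniteType g] :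
    topologicalKrullDim ↥(pullback f g) ≤ topologicalKrullDim X + topologicalKrullDim Y := by
  refine topologicalKrullDim_le_of_forall_isOpenEmbedding _ fun z => ?_
  let 𝒰 := Scheme.Pullback.openCoverOfLeftRight X.affineCover Y.affineCover f g
  obtain ⟨i, x, hx⟩ := 𝒰.exists_eq z
  refine ⟨𝒰.X i, inferInstance, 𝒰.f i, (𝒰.f i).isOpenEmbedding, ⟨x, hx⟩, ?_⟩
  have hf : LocallyOfFiniteType (X.affineCover.f i.1 ≫ f) := inferInstance
  have hg : LocallyOfFiniteType (Y.affineCover.f i.2 ≫ g) := inferInstance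
  refine (@topologicalKrullDim_pullback_Spec_le _ _ _ _ (X.affineCover.f i.1 ≫ f)
    (Y.affineCover.f i.2 ≫ g) hf hg).trans (add_le_add ?_ ?_)
  · exact (X.affineCover.f i.1).isOpenEmbedding.isInducing.topologicalKrullDim_le
  · exact (Y.affineCover.f i.2).isOpenEmbedding.isInducing.topologicalKrullDim_le

/-- Finitely many affine charts, each of finite dimension. Needed so that the natural number `dim`
is the true Krull dimension. -/
theorem topologicalKrullDim_lt_top {X : Scheme.{u}} (f : X ⟶ Spec (.of K))
    [LocallyOfFiniteType f] [CompactSpace X] : topologicalKrullDim X < ⊤ := by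
  let 𝒰 := X.affineCover.finiteSubcover
  have hfin (i : 𝒰.I₀) : topologicalKrullDim ↥(𝒰.X i) < ⊤ := by
    have : IsAffine (𝒰.X i) := Scheme.isAffine_affineCover X _
    obtain ⟨φ, hφ⟩ := Spec.map_surjective ((𝒰.X i).isoSpec.inv ≫ 𝒰.f i ≫ f)
    have h1 : φ.hom.FiniteType :=
      (HasRingHomProperty.Spec_iff (P := @LocallyOfFiniteType)).1 (hφ ▸ inferInstance)
    algebraize [φ.hom]
    refine lt_of_le_of_lt ?_ (ringKrullDim_lt_top_of_finiteType K Γ(𝒰.X i, ⊤))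
    rw [← PrimeSpectrum.topologicalKrullDim_eq_ringKrullDim]
    exact Topology.IsInducing.topologicalKrullDim_le (f := (𝒰.X i).isoSpec.hom)
      (𝒰.X i).isoSpec.hom.homeomorph.isInducing
  have : Fintype 𝒰.I₀ := Fintype.ofFinite _
  refine lt_of_le_of_lt (b := Finset.univ.sup fun i => topologicalKrullDim ↥(𝒰.X i)) ?_
    ((Finset.sup_lt_iff bot_lt_top).2 fun i _ => hfin i)
  refine topologicalKrullDim_le_of_forall_isOpenEmbedding _ fun z => ?_
  obtain ⟨i, x, hx⟩ := 𝒰.exists_eq z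
  exact ⟨𝒰.X i, inferInstance, 𝒰.f i, (𝒰.f i).isOpenEmbedding, ⟨x, hx⟩,
    Finset.le_sup (f := fun i => topologicalKrullDim ↥(𝒰.X i)) (Finset.mem_univ i)⟩

theorem exists_isClosedImmersion_range_eq {X : Scheme.{u}} (Z : Set X) (hZ : IsClosed Z) :
    ∃ (T : Scheme.{u}) (i : T ⟶ X), IsClosedImmersion i ∧ Set.range i = Z :=
  ⟨_, (Scheme.IdealSheafData.vanishingIdeal ⟨Z, hZ⟩).subschemeι, inferInstance,
    Scheme.IdealSheafData.range_subschemeι _⟩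

/-- The dimension of the product of two closed subsets is at most the sum of the dimensions. -/
theorem topologicalKrullDim_preimage_inter_preimage_le {X Y : Scheme.{u}} (f : X ⟶ Spec (.of K))
    (g : Y ⟶ Spec (.of K)) [LocallyOfFiniteType f] [LocallyOfFiniteType g] {Z : Set X} {W : Set Y}
    (hZ : IsClosed Z) (hW : IsClosed W) :
    topologicalKrullDim ↥(pullback.fst f g ⁻¹' Z ∩ pullback.snd f g ⁻¹' W) ≤
      topologicalKrullDim Z + topologicalKrullDim W := by
  -- With scheme structures on `Z` and `W`, the set in question is the range of a closed immersion
  -- from their fibre product.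
  obtain ⟨S, i, hi, rfl⟩ := exists_isClosedImmersion_range_eq Z hZ
  obtain ⟨T, j, hj, rfl⟩ := exists_isClosedImmersion_range_eq W hW
  let p := pullback.map (i ≫ f) (j ≫ g) f g i j (𝟙 _) (by simp) (by simp)
  have hp : Set.range p = _ := Scheme.Pullback.range_map (i ≫ f) (j ≫ g) f g i j (𝟙 _) _ _
  have : MorphismProperty.IsStableUnderComposition @IsClosedImmersion :=
    ⟨fun _ _ _ _ => inferInstance⟩
  have : IsClosedImmersion p := MorphismProperty.pullbackMap (P := @IsClosedImmersion) hi hj rfl rfl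
  rw [← hp]
  refine (IsInducing.topologicalKrullDim_le
    p.isClosedEmbedding.isEmbedding.toHomeomorph.symm.isInducing).trans ?_
  refine (topologicalKrullDim_pullback_le (i ≫ f) (j ≫ g)).trans ?_
  gcongr
  · exact IsInducing.topologicalKrullDim_le
      i.isClosedEmbedding.isEmbedding.toHomeomorph.isInducing
  · exact IsInducing.topologicalKrullDim_le
      j.isClosedEmbedding.isEmbedding.toHomeomorph.isInducing

end TorsionAnomalous

end

/-! ### From schemes to `K`-points -/

section

open CategoryTheory AlgebraicGeometry MonoidalCategory CartesianMonoidalCategory Limits Topology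
namespace TorsionAnomalous
variable {K : Type u} [Field K]  {A B : Over (Spec (.of K))}

/-- The map on `K`-points induced by a morphism of `K`-schemes. -/
noncomputable def Point.map (f : A ⟶ B) (x : Point A) : Point B :=
  (show 𝟙_ (Over (Spec (.of K))) ⟶ A from x) ≫ f

@[simp]
theorem Point.toScheme_map (f : A ⟶ B) (x : Point A) :
    (x.map f).toScheme = f.left x.toScheme := rfl

theorem Point.isInducing_toScheme : IsInducing (Point.toScheme (A := A)) := ⟨rfl⟩

theorem Point.continuous_map (f : A ⟶ B) : Continuous (Point.map f) :=
  Point.isInducing_toScheme.continuous_iff.2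
    (f.left.continuous.comp Point.isInducing_toScheme.continuous)

variable [LocallyOfFiniteType A.hom]

theorem Point.topologicalKrullDim_lt_top [CompactSpace A.left] :
    topologicalKrullDim (Point A) < ⊤ :=
  (Point.isInducing_toScheme.topologicalKrullDim_le).trans_lt
    (TorsionAnomalous.topologicalKrullDim_lt_top A.hom)

theorem Point.noetherianSpace [CompactSpace A.left] :
    TopologicalSpace.NoetherianSpace (Point A) := by
  have : IsLocallyNoetherian A.left := LocallyOfFiniteType.isLocallyNoetherian A.hom
  have : IsNoetherian A.left := {}
  exact Point.isInducing_toScheme.noetherianSpace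

variable [IsAlgClosed K] [LocallyOfFiniteType B.hom]

theorem Point.toScheme_injective : Function.Injective (Point.toScheme (A := A)) := by
  intro x y h
  have hx := Over.w x
  have hy := Over.w y
  exact Over.OverMorphism.ext (ext_of_apply_closedPoint_eq A.hom hx hy h)

theorem Point.range_toScheme : Set.range (Point.toScheme (A := A)) = closedPoints A.left := by
  ext z
  constructor
  · rintro ⟨x, rfl⟩
    exact (pointEquivClosedPoint A.hom ⟨Over.Hom.left x, Over.w x⟩).2
  · intro hz
    exact ⟨Over.homMk (pointOfClosedPoint A.hom z hz) (pointOfClosedPoint_comp A.hom z hz),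
      pointOfClosedPoint_apply A.hom z hz _⟩

/-- The fibre of a closed set over a closed point is locally closed, so if nonempty it contains a
closed point, that is, a `K`-point. -/
theorem Point.isClosedMap_map (f : A ⟶ B) (hf : IsClosedMap f.left) :
    IsClosedMap (Point.map f) := by
  have : JacobsonSpace A.left := LocallyOfFiniteType.jacobsonSpace A.hom
  intro S hS
  obtain ⟨Z, hZ, rfl⟩ := Point.isInducing_toScheme.isClosed_iff.1 hS
  convert (hf Z hZ).preimage (Point.isInducing_toScheme (A := B)).continuous using 1
  ext y
  constructor
  · rintro ⟨x, hx, rfl⟩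
    exact ⟨x.toScheme, hx, rfl⟩
  · rintro ⟨z, hz, hzy⟩
    have hy : IsClosed {y.toScheme} := by
      have : y.toScheme ∈ closedPoints B.left := Point.range_toScheme (A := B) ▸ ⟨y, rfl⟩
      exact this
    obtain ⟨w, ⟨hw, hwy⟩, hwc⟩ := nonempty_inter_closedPoints (Z := Z ∩ f.left ⁻¹' {y.toScheme})
      ⟨z, hz, hzy⟩ (hZ.inter (hy.preimage f.left.continuous)).isLocallyClosed
    rw [← Point.range_toScheme] at hwc
    obtain ⟨x, rfl⟩ := hwc
    exact ⟨x, hw, Point.toScheme_injective hwy⟩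

/-- The closure of a closed set `S` of points in the scheme has at most the dimension of `S`. -/
theorem Point.topologicalKrullDim_closure_le {S : Set (Point A)} (hS : IsClosed S) :
    topologicalKrullDim (closure (Point.toScheme '' S)) ≤ topologicalKrullDim S := by
  have : JacobsonSpace A.left := LocallyOfFiniteType.jacobsonSpace A.hom
  refine topologicalKrullDim_le_of_range_eq_closedPoints (j := fun x : S => x.1.toScheme)
    (Point.isInducing_toScheme.comp IsInducing.subtypeVal)
    isClosed_closure.isClosedEmbedding_subtypeVal ?_
  rw [Subtype.range_coe, ← Point.range_toScheme]
  have h := hS.closure_eq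
  rw [Point.isInducing_toScheme.closure_eq_preimage_closure_image] at h
  ext z
  constructor
  · rintro ⟨x, rfl⟩
    exact ⟨⟨_, rfl⟩, subset_closure ⟨_, x.2, rfl⟩⟩
  · rintro ⟨⟨x, rfl⟩, hx⟩
    exact ⟨⟨x, h ▸ hx⟩, rfl⟩

/-- The dimension of the product of two closed subsets is at most the sum of the dimensions. -/
theorem Point.topologicalKrullDim_prod_le {S : Set (Point A)} {T : Set (Point B)}
    (hS : IsClosed S) (hT : IsClosed T) :
    topologicalKrullDim ↥(Point.map (fst A B) ⁻¹' S ∩ Point.map (snd A B) ⁻¹' T) ≤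
      topologicalKrullDim S + topologicalKrullDim T := by
  refine le_trans ?_ ((topologicalKrullDim_preimage_inter_preimage_le A.hom B.hom isClosed_closure
    isClosed_closure).trans (add_le_add (topologicalKrullDim_closure_le hS)
      (topologicalKrullDim_closure_le hT)))
  refine IsInducing.topologicalKrullDim_le (f := fun z => ⟨z.1.toScheme,
    subset_closure ⟨_, z.2.1, rfl⟩, subset_closure ⟨_, z.2.2, rfl⟩⟩) ?_
  exact IsInducing.of_comp
    ((Point.isInducing_toScheme.continuous.comp continuous_subtype_val).subtype_mk _)
    continuous_subtype_val
    (Point.isInducing_toScheme.comp IsInducing.subtypeVal)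

end TorsionAnomalous

end

/-! ### Group structure, shears and the dimension inequality -/

section

open CategoryTheory AlgebraicGeometry MonoidalCategory CartesianMonoidalCategory Limits Topology
namespace TorsionAnomalous
variable {K : Type u} [Field K] {A B : Over (Spec (.of K))}

theorem Point.map_comp {C : Over (Spec (.of K))} (f : A ⟶ B) (g : B ⟶ C) (x : Point A) :
    x.map (f ≫ g) = (x.map f).map g :=
  (Category.assoc _ _ _).symm

@[simp]
theorem Point.map_id (x : Point A) : x.map (𝟙 A) = x :=
  Category.comp_id _

/-- The constant morphism with value `x`. -/
noncomputable def Point.const (B : Over (Spec (.of K))) (x : Point A) : B ⟶ A :=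
  toUnit B ≫ (show 𝟙_ (Over (Spec (.of K))) ⟶ A from x)

theorem Point.map_const (x : Point A) (y : Point B) : y.map (x.const B) = x := by
  change _ ≫ toUnit B ≫ _ = _
  rw [← Category.assoc, toUnit_unique (_ ≫ toUnit B) (𝟙 _), Category.id_comp]

theorem Point.prod_ext {x y : Point (A ⊗ B)} (h₁ : x.map (fst A B) = y.map (fst A B))
    (h₂ : x.map (snd A B) = y.map (snd A B)) : x = y :=
  CartesianMonoidalCategory.hom_ext _ _ h₁ h₂

theorem Point.map_lift_fst {C : Over (Spec (.of K))} (f : C ⟶ A) (g : C ⟶ B) (x : Point C) :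
    (x.map (lift f g)).map (fst A B) = x.map f := by
  rw [← Point.map_comp, lift_fst]

theorem Point.map_lift_snd {C : Over (Spec (.of K))} (f : C ⟶ A) (g : C ⟶ B) (x : Point C) :
    (x.map (lift f g)).map (snd A B) = x.map g := by
  rw [← Point.map_comp, lift_snd]

theorem Point.exists_prod (x : Point A) (y : Point B) :
    ∃ z : Point (A ⊗ B), z.map (fst A B) = x ∧ z.map (snd A B) = y :=
  ⟨lift (show 𝟙_ (Over (Spec (.of K))) ⟶ A from x) y, lift_fst _ _, lift_snd _ _⟩

/-- The product of two sets of points, as a set of points of `A ⊗ A`. -/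
def prodSet (S T : Set (Point A)) : Set (Point (A ⊗ A)) :=
  Point.map (fst A A) ⁻¹' S ∩ Point.map (snd A A) ⁻¹' T

theorem isClosed_prodSet {S T : Set (Point A)} (hS : IsClosed S) (hT : IsClosed T) :
    IsClosed (prodSet S T) :=
  (hS.preimage (Point.continuous_map _)).inter (hT.preimage (Point.continuous_map _))

/-- Excludes the two cases, `⊥` and `⊤`, where the truncations in `dim` lose information. -/
theorem dim_eq {S : Set (Point A)} (hS : S.Nonempty) (hlt : topologicalKrullDim S < ⊤) :
    topologicalKrullDim S = dim S := by
  have : Nonempty S := hS.to_subtype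
  have : Nonempty (TopologicalSpace.IrreducibleCloseds S) :=
    ⟨⟨_, isIrreducible_irreducibleComponent (x := Classical.arbitrary S),
      isClosed_irreducibleComponent⟩⟩
  obtain ⟨n, hn⟩ := WithBot.ne_bot_iff_exists.1
    (show topologicalKrullDim S ≠ ⊥ from Order.krullDim_ne_bot_iff.2 this)
  rw [dim, ← hn, WithBot.unbotD_coe]
  rw [← hn] at hlt
  have : n ≠ ⊤ := by rintro rfl; exact hlt.ne rfl
  exact congrArg _ (ENat.natCast_toNat this).symm

variable [GrpObj A]

theorem Point.map_mul (f g : B ⟶ A) (x : Point B) : x.map (f * g) = x.map f * x.map g :=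
  MonObj.comp_mul _ _ _

theorem Point.map_inv (f : B ⟶ A) (x : Point B) : x.map f⁻¹ = (x.map f)⁻¹ :=
  GrpObj.comp_inv _ _

theorem Point.map_mulHom (z : Point (A ⊗ A)) :
    z.map μ[A] = z.map (fst A A) * z.map (snd A A) := by
  rw [MonObj.mul_eq_mul, Point.map_mul]

theorem Point.continuous_mul_left (x : Point A) : Continuous fun y : Point A => x * y := by
  convert Point.continuous_map (x.const A * 𝟙 A) using 2
  rw [Point.map_mul, Point.map_const, Point.map_id]

theorem Point.isInducing_mul_left (x : Point A) : IsInducing fun y : Point A => x * y := by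
  refine IsInducing.of_comp (Point.continuous_mul_left x) (Point.continuous_mul_left x⁻¹) ?_
  convert IsInducing.id using 1
  ext y
  simp

theorem Point.topologicalKrullDim_le_smul (x : Point A) (S : Set (Point A)) :
    topologicalKrullDim S ≤ topologicalKrullDim ↥(x • S) := by
  refine IsInducing.topologicalKrullDim_le
    (f := fun y => (⟨x * y.1, Set.smul_mem_smul_set y.2⟩ : ↥(x • S))) ?_
  exact IsInducing.of_comp
    (((Point.continuous_mul_left x).comp continuous_subtype_val).subtype_mk _)
    continuous_subtype_val ((Point.isInducing_mul_left x).comp IsInducing.subtypeVal)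

/-- The morphism `(x, y) ↦ (x * d, d⁻¹ * y)`. -/
noncomputable def shear (d : Point A) : A ⊗ A ⟶ A ⊗ A :=
  lift (fst A A * d.const _) ((d.const _)⁻¹ * snd A A)

theorem map_shear_fst (d : Point A) (z : Point (A ⊗ A)) :
    (z.map (shear d)).map (fst A A) = z.map (fst A A) * d := by
  rw [shear, Point.map_lift_fst, Point.map_mul, Point.map_const]

theorem map_shear_snd (d : Point A) (z : Point (A ⊗ A)) :
    (z.map (shear d)).map (snd A A) = d⁻¹ * z.map (snd A A) := by
  rw [shear, Point.map_lift_snd, Point.map_mul, Point.map_inv, Point.map_const]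

/-- The Zariski topology on `A ⊗ A` is not the product topology, so continuity is not checked
coordinatewise: the orbit map is exhibited as induced by a morphism `A ⟶ A ⊗ A`. -/
theorem continuous_map_shear (z : Point (A ⊗ A)) :
    Continuous fun d : Point A => z.map (shear d) := by
  convert Point.continuous_map
    (lift ((z.map (fst A A)).const A * 𝟙 A) ((𝟙 A)⁻¹ * (z.map (snd A A)).const A)) using 2 with d
  apply Point.prod_ext
  · rw [map_shear_fst, Point.map_lift_fst, Point.map_mul, Point.map_const, Point.map_id]
  · rw [map_shear_snd, Point.map_lift_snd, Point.map_mul, Point.map_const, Point.map_inv,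
      Point.map_id]

theorem isInducing_map_shear (z : Point (A ⊗ A)) :
    IsInducing fun d : Point A => z.map (shear d) := by
  refine IsInducing.of_comp (continuous_map_shear z) (Point.continuous_map (fst A A)) ?_
  convert Point.isInducing_mul_left (z.map (fst A A)) using 2 with d
  exact map_shear_fst d z

theorem image_prodSet (S T : Set (Point A)) : Point.map μ[A] '' prodSet S T = S * T := by
  ext x
  constructor
  · rintro ⟨z, ⟨h1, h2⟩, rfl⟩
    rw [Point.map_mulHom]
    exact Set.mul_mem_mul h1 h2
  · rintro ⟨s, hs, t, ht, rfl⟩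
    obtain ⟨z, rfl, rfl⟩ := Point.exists_prod s t
    exact ⟨z, ⟨hs, ht⟩, Point.map_mulHom z⟩

section Proper

variable [IsProper A.hom]

/-- `A ⊗ A` is proper over the base and `A` is separated, so multiplication is proper. -/
theorem isClosedMap_mul_left : IsClosedMap μ[A].left := by
  have : IsProper (A ⊗ A).hom := by dsimp; infer_instance
  have : IsProper (μ[A].left ≫ A.hom) := by rw [Over.w]; infer_instance
  have : IsProper μ[A].left := .of_comp _ A.hom
  exact μ[A].left.isClosedMap

variable [IsAlgClosed K]

theorem Point.isClosedMap_mul : IsClosedMap (Point.map μ[A]) := by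
  have : IsProper (A ⊗ A).hom := by dsimp; infer_instance
  exact Point.isClosedMap_map _ isClosedMap_mul_left

theorem isClosed_mul {S T : Set (Point A)} (hS : IsClosed S) (hT : IsClosed T) :
    IsClosed (S * T) := by
  rw [← image_prodSet]
  exact Point.isClosedMap_mul _ (isClosed_prodSet hS hT)

/-- If `H * B = A` and `E ⊆ H ∩ B` is irreducible and contains `1`, then
`dim A + dim E ≤ dim H + dim B`. -/
theorem add_le_add_topologicalKrullDim {H B : Subgroup (Point A)} (hH : IsAlgebraicSubgroup H)
    (hB : IsAlgebraicSubgroup B) (hHB : (H : Set (Point A)) * (B : Set (Point A)) = Set.univ)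
    {E : Set (Point A)}
    (hE : IsIrreducible E) (hE1 : 1 ∈ E) (hEH : E ⊆ H) (hEB : E ⊆ B) {m n : ℕ}
    (hm : m ≤ topologicalKrullDim E) (hn : n ≤ topologicalKrullDim (Point A)) :
    (n + m : ℕ) ≤ topologicalKrullDim H + topologicalKrullDim B := by
  refine le_trans ?_ (Point.topologicalKrullDim_prod_le hH hB)
  change _ ≤ topologicalKrullDim ↥(prodSet (H : Set (Point A)) B)
  have : IrreducibleSpace E := Subtype.irreducibleSpace hE
  have : IsProper (A ⊗ A).hom := by dsimp; infer_instance
  have : CompactSpace (A ⊗ A).left := QuasiCompact.compactSpace_of_compactSpace (A ⊗ A).hom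
  have : TopologicalSpace.NoetherianSpace (Point (A ⊗ A)) := Point.noetherianSpace
  -- `E` need not be a group: stability only asks `d ∈ H` and `d⁻¹ ∈ B`, and `1 ∈ E` supplies the
  -- identity transformation.
  let a (d : E) (z : prodSet (H : Set (Point A)) B) : prodSet (H : Set (Point A)) B :=
    ⟨z.1.map (shear d.1), by
      rw [Set.mem_preimage, map_shear_fst]
      exact H.mul_mem z.2.1 (hEH d.2), by
      rw [Set.mem_preimage, map_shear_snd]
      exact B.mul_mem (B.inv_mem (hEB d.2)) z.2.2⟩
  refine add_le_topologicalKrullDim_of_invariant (a := a) (e := ⟨1, hE1⟩)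
    (f := fun z => z.1.map μ[A]) ?_ ?_ ?_ ?_ ?_ ?_ ?_ hm hn
  · exact fun d => ((Point.continuous_map _).comp continuous_subtype_val).subtype_mk _
  · intro z
    exact IsInducing.of_comp
      (((continuous_map_shear z.1).comp continuous_subtype_val).subtype_mk _)
      continuous_subtype_val ((isInducing_map_shear z.1).comp IsInducing.subtypeVal)
  · intro z
    refine Subtype.ext (Point.prod_ext ?_ ?_)
    · simp [a, map_shear_fst]
    · simp [a, map_shear_snd]
  · exact (Point.continuous_map _).comp continuous_subtype_val
  · exact Point.isClosedMap_mul.comp (isClosed_prodSet hH hB).isClosedEmbedding_subtypeVal.isClosedMap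
  · intro x
    obtain ⟨z, hz, rfl⟩ : x ∈ Point.map μ[A] '' prodSet (H : Set (Point A)) B := by
      rw [image_prodSet, hHB]
      exact Set.mem_univ x
    exact ⟨⟨z, hz⟩, rfl⟩
  · intro d z
    simp [a, Point.map_mulHom, map_shear_fst, map_shear_snd, mul_assoc]

end Proper

theorem Point.mul_comm [IsCommMonObj A] (x y : Point A) : x * y = y * x :=
  _root_.mul_comm (G := (𝟙_ (Over (Spec (.of K))) ⟶ A)) x y

end TorsionAnomalous

end

/-! ### The theorem -/

open TorsionAnomalous in
theorem theorem1p1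
    (A : Over (Spec (.of (AlgebraicClosure ℚ))))
    [GrpObj A] [IsProper A.hom] [GeometricallyIntegral A.hom]
    (H : Subgroup (TorsionAnomalous.Point A)) (hH : TorsionAnomalous.IsAlgebraicSubgroup H)
    (p : TorsionAnomalous.Point A)
    (hw : TorsionAnomalous.IsWeakTransverse (p • (H : Set (TorsionAnomalous.Point A)))) :
    {Y : Set (TorsionAnomalous.Point A) |
      TorsionAnomalous.IsTorsionAnomalous (p • (H : Set (TorsionAnomalous.Point A))) Y} = ∅ := by
  refine Set.eq_empty_of_forall_notMem ?_
  rintro Y ⟨B, ζ, ⟨hB, -, hζ⟩, -, ⟨⟨hYi, hYsub⟩, -⟩, hlt⟩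
  -- Commutativity of abelian varieties; it makes `B` normal, so that `H * B` is a subgroup.
  have : IsCommMonObj A := isCommMonObj_of_isProper_of_geometricallyIntegral A
  have : B.Normal := ⟨fun n hn g => by
    rwa [TorsionAnomalous.Point.mul_comm g n, mul_inv_cancel_right]⟩
  have hsup : ((H ⊔ B : Subgroup (Point A)) : Set (Point A)) =
      (H : Set (Point A)) * (B : Set (Point A)) := Subgroup.mul_normal H B
  obtain ⟨y, hy⟩ := hYi.nonempty
  obtain ⟨⟨h, hh, hyh⟩, ⟨b, hb, hyb⟩⟩ := hYsub hy
  have hyh : p * h = y := hyh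
  have hyb : ζ * b = y := hyb
  have htop : H ⊔ B = ⊤ := by
    by_contra hne
    -- From `p * h = y = ζ * b` one gets `p = ζ * b * h⁻¹`, so `p • H` lies in this single torsion
    -- translate.
    refine hw.2.2 (ζ • ((H ⊔ B : Subgroup (Point A)) : Set (Point A)))
      ⟨{_}, Set.finite_singleton _, ?_, (Set.sUnion_singleton _).symm⟩ ?_
    · rintro _ rfl
      exact ⟨H ⊔ B, ζ, ⟨by rw [IsAlgebraicSubgroup, hsup]; exact isClosed_mul hH hB, hne, hζ⟩, rfl⟩
    · rintro _ ⟨x, hx, rfl⟩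
      rw [Set.mem_smul_set_iff_inv_smul_mem]
      have : ζ⁻¹ • p • x = b * (h⁻¹ * x) := by
        have hp : p = ζ * b * h⁻¹ := by rw [hyb, ← hyh, mul_inv_cancel_right]
        simp [hp, mul_assoc]
      change ζ⁻¹ • p • x ∈ H ⊔ B
      rw [this]
      exact mul_mem (le_sup_right (a := H) hb)
        (le_sup_left (b := B) (H.mul_mem (H.inv_mem hh) hx))
  have hcompact : CompactSpace A.left := QuasiCompact.compactSpace_of_compactSpace A.hom
  have hfin (S : Set (Point A)) : topologicalKrullDim S < ⊤ :=
    (topologicalKrullDim_subspace_le _ S).trans_lt Point.topologicalKrullDim_lt_top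
  -- Translating by `y⁻¹` moves `Y` into `H ∩ B` and `y` to `1`, without lowering the dimension.
  have hE : IsIrreducible (y⁻¹ • Y) :=
    hYi.image _ (Point.continuous_mul_left y⁻¹).continuousOn
  have key := add_le_add_topologicalKrullDim hH hB (by rw [← hsup, htop]; rfl) hE
    ⟨y, hy, inv_mul_cancel y⟩ (E := y⁻¹ • Y) (m := dim Y)
    (n := dim (Set.univ : Set (Point A))) (by
      rintro _ ⟨x, hx, rfl⟩
      obtain ⟨h', hh', hx'⟩ := (hYsub hx).1
      have hx' : p * h' = x := hx'
      change y⁻¹ * x ∈ H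
      rw [← hx', ← hyh, mul_inv_rev, mul_assoc, inv_mul_cancel_left]
      exact H.mul_mem (H.inv_mem hh) hh') (by
      rintro _ ⟨x, hx, rfl⟩
      obtain ⟨b', hb', hx'⟩ := (hYsub hx).2
      have hx' : ζ * b' = x := hx'
      change y⁻¹ * x ∈ B
      rw [← hx', ← hyb, mul_inv_rev, mul_assoc, inv_mul_cancel_left]
      exact B.mul_mem (B.inv_mem hb) hb') (by
      rw [← dim_eq hYi.nonempty (hfin _)]
      exact Point.topologicalKrullDim_le_smul y⁻¹ Y) (by
      rw [← dim_eq Set.univ_nonempty (hfin _)]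
      exact topologicalKrullDim_subspace_le _ _)
  have key2 := key.trans (add_le_add_left (Point.topologicalKrullDim_le_smul p (H : Set (Point A))) _)
  rw [dim_eq hw.2.1.nonempty (hfin _),
    show topologicalKrullDim ↥B = _ from dim_eq (S := (B : Set (Point A))) ⟨1, B.one_mem⟩ (hfin _)]
    at key2
  have key3 : dim (Set.univ : Set (Point A)) + dim Y ≤
      dim (p • (H : Set (Point A))) + dim (B : Set (Point A)) := by exact_mod_cast key2
  -- Unfolded, anomaly says `dim (p • H) + dim B < dim A + dim Y`, the negation of `key3`.
  simp only [codim] at hlt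
  omega
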